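/- Let $k$ be a field, let $n\ge 0$ be an integer, and let $\mathcal A=\{a_{ij}\in k \mid 1\le i<j\le n\}$ be a set of scalars. Let $V_n(\mathcal A)$ be the $k$-algebra generated by $x_1,\dots,x_n$ subject to the relations $$x_ix_j+x_jx_i=a_{ij}\qquad (1\le i<j\le n),$$ and let $G=\{\pm 1\}$ be the subgroup of $\operatorname{Aut}(V_n(\mathcal A))$ generated by the automorphism $-1\colon x_i\mapsto -x_i$ $(i=1,\dots,n)$. Call a ring regular if it is left and right noetherian and has finite left and right global dimension. If $a_{ij}\ne 0$ for some $i<j$, then the fixed ring $V_n(\mathcal A)^G$ is regular. -/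

import Mathlib

open CategoryTheory

universe u

/-- A (possibly noncommutative) ring has left global dimension at most `d` if every left module has
projective dimension at most `d`. -/
def LeftGlobalDimensionLE (R : Type u) [Ring R] (d : ℕ) : Prop :=
  ∀ M : ModuleCat.{u} R, HasProjectiveDimensionLE M d

/-- A (possibly noncommutative) ring is regular if it is left and right noetherian and has finite
left and right global dimension. Right modules over `R` are left modules over `Rᵐᵒᵖ`. -/
structure IsNoncommRegular (R : Type u) [Ring R] : Prop where
  left_noetherian : IsNoetherianRing R
  right_noetherian : IsNoetherianRing Rᵐᵒᵖ
  left_gldim : ∃ d : ℕ, LeftGlobalDimensionLE R d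
  right_gldim : ∃ d : ℕ, LeftGlobalDimensionLE Rᵐᵒᵖ d

namespace ModifiedQuantumWeyl

variable {k : Type u} [Field k] {n : ℕ}

/-- The defining relations `x i * x j + x j * x i = a i j` for `i < j`. Only the scalars `a i j` with
`i < j` matter. -/
inductive Rel (a : Fin n → Fin n → k) : FreeAlgebra k (Fin n) → FreeAlgebra k (Fin n) → Prop
  | anticomm (i j : Fin n) (hij : i < j) :
      Rel a (FreeAlgebra.ι k i * FreeAlgebra.ι k j + FreeAlgebra.ι k j * FreeAlgebra.ι k i)
        (algebraMap k (FreeAlgebra k (Fin n)) (a i j))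

/-- The modified `(-1)`-quantum Weyl algebra `V_n(A)`. -/
def V (a : Fin n → Fin n → k) : Type u := RingQuot (Rel a)

noncomputable section

instance (a : Fin n → Fin n → k) : Ring (V a) := inferInstanceAs (Ring (RingQuot (Rel a)))

instance (a : Fin n → Fin n → k) : Algebra k (V a) :=
  inferInstanceAs (Algebra k (RingQuot (Rel a)))

/-- The quotient map from the free algebra. -/
def mk (a : Fin n → Fin n → k) : FreeAlgebra k (Fin n) →ₐ[k] V a :=
  RingQuot.mkAlgHom k (Rel a)

/-- The generators of `V_n(A)`. -/
def x (a : Fin n → Fin n → k) (i : Fin n) : V a :=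
  mk a (FreeAlgebra.ι k i)

theorem x_anticomm (a : Fin n → Fin n → k) (i j : Fin n) (hij : i < j) :
    x a i * x a j + x a j * x a i = algebraMap k (V a) (a i j) := by
  have h : mk a _ = mk a _ := RingQuot.mkAlgHom_rel k (Rel.anticomm (a := a) i j hij)
  simpa [x] using h

/-- The algebra endomorphism of `V_n(A)` sending each `x i` to `-x i`. -/
def negHom (a : Fin n → Fin n → k) : V a →ₐ[k] V a :=
  RingQuot.liftAlgHom k ⟨FreeAlgebra.lift k fun i => -x a i, by
    rintro _ _ ⟨i, j, hij⟩
    simpa using x_anticomm a i j hij⟩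

theorem negHom_x (a : Fin n → Fin n → k) (i : Fin n) : negHom a (x a i) = -x a i := by
  have h : negHom a (x a i) = FreeAlgebra.lift k (fun i => -x a i) (FreeAlgebra.ι k i) :=
    RingQuot.liftAlgHom_mkAlgHom_apply k _ _ _
  simpa using h

theorem negHom_comp_negHom (a : Fin n → Fin n → k) :
    (negHom a).comp (negHom a) = AlgHom.id k (V a) := by
  apply RingQuot.ringQuot_ext'
  apply FreeAlgebra.hom_ext
  funext i
  change negHom a (negHom a (x a i)) = x a i
  simp [negHom_x]

/-- The automorphism `-1` of `V_n(A)`, sending each `x i` to `-x i`. -/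
def negAut (a : Fin n → Fin n → k) : V a ≃ₐ[k] V a :=
  AlgEquiv.ofAlgHom (negHom a) (negHom a) (negHom_comp_negHom a) (negHom_comp_negHom a)

/-- The subgroup `{±1}` of the automorphism group of `V_n(A)`, generated by `-1`. -/
def signGroup (a : Fin n → Fin n → k) : Subgroup (V a ≃ₐ[k] V a) :=
  Subgroup.zpowers (negAut a)

/-- The fixed subring of `V_n(A)` under the subgroup `{±1}`. -/
abbrev fixedRing (a : Fin n → Fin n → k) : Subalgebra k (V a) :=
  FixedPoints.subalgebra k (V a) (signGroup a)

end

end ModifiedQuantumWeyl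

/-! Adjoining the generators one at a time makes `V a` an iterated Ore extension of a quotient of
`k`, so its left global dimension is at most `n`. It is noetherian, being finite over the image of a
polynomial ring in the central squares of the generators.

In characteristic two, `-1` is the identity and the fixed ring is all of `V a`. Otherwise averaging
over `±1` retracts `V a` onto the fixed ring as bimodules, and noetherianity descends
(`IsNoetherianRing.of_retraction`). Global dimension descends too
(`LeftGlobalDimensionLE.of_retraction`) once `V a` is projective over the fixed ring. This is where
a nonzero `a i j` enters: `1` is a scalar multiple of `x i * x j + x j * x i`, a sum of products of
odd elements, and this yields a dual basis (`projective_fixedRing`).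

The anti-automorphism fixing the generators commutes with `-1`, so the fixed ring is its own
opposite and the right-hand conditions follow from the left-hand ones. -/

/-! ### Dimension shifting along exact functors. -/

section Homological

open Limits

universe v w

variable {C : Type v} {D : Type w} [Category.{u} C] [Category.{u} D] [Abelian C] [Abelian D]

/-- A functor preserving short exact sequences and injective objects does not increase the
injective dimension. -/
theorem hasInjectiveDimensionLT_functor_obj [EnoughInjectives C] (F : C ⥤ D)
    [F.PreservesZeroMorphisms] [F.PreservesInjectiveObjects]
    (hF : ∀ S : ShortComplex C, S.ShortExact → (S.map F).ShortExact) (n : ℕ) (X : C)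
    (hX : HasInjectiveDimensionLT X (n + 1)) : HasInjectiveDimensionLT (F.obj X) (n + 1) := by
  induction n generalizing X with
  | zero =>
    have : Injective X := injective_iff_hasInjectiveDimensionLT_one.2 hX
    infer_instance
  | succ n ih =>
    -- The cokernel of an embedding of `X` into an injective has dimension one less, and `F`
    -- preserves this situation.
    obtain ⟨p⟩ := EnoughInjectives.presentation X
    have h : (ShortComplex.mk _ _ (cokernel.condition p.f)).ShortExact :=
      { exact := ShortComplex.exact_cokernel p.f }
    have hp : Injective p.J := p.injective
    have h' := hF _ h
    exact (h'.hasInjectiveDimensionLT_X₃_iff n (F.injective_obj_of_injective hp)).1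
      (ih _ ((h.hasInjectiveDimensionLT_X₃_iff n hp).2 hX))

/-- A functor preserving short exact sequences and projective objects does not increase the
projective dimension. -/
theorem hasProjectiveDimensionLT_functor_obj [EnoughProjectives C] (F : C ⥤ D)
    [F.PreservesZeroMorphisms] [F.PreservesProjectiveObjects]
    (hF : ∀ S : ShortComplex C, S.ShortExact → (S.map F).ShortExact) (n : ℕ) (X : C)
    (hX : HasProjectiveDimensionLT X (n + 1)) : HasProjectiveDimensionLT (F.obj X) (n + 1) := by
  induction n generalizing X with
  | zero =>
    have : Projective X := projective_iff_hasProjectiveDimensionLT_one.2 hX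
    infer_instance
  | succ n ih =>
    obtain ⟨p⟩ := EnoughProjectives.presentation X
    have h : (ShortComplex.mk _ _ (kernel.condition p.f)).ShortExact :=
      { exact := ShortComplex.exact_kernel p.f }
    have hp : Projective p.p := p.projective
    have h' := hF _ h
    exact (h'.hasProjectiveDimensionLT_X₃_iff n (F.projective_obj_of_projective hp)).2
      (ih _ ((h.hasProjectiveDimensionLT_X₃_iff n hp).1 hX))

/-- In an abelian category with extension groups, uniform bounds on injective dimensions are
uniform bounds on projective dimensions. -/
theorem forall_hasProjectiveDimensionLT_iff (n : ℕ) :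
    (∀ X : C, HasProjectiveDimensionLT X n) ↔ ∀ X : C, HasInjectiveDimensionLT X n := by
  let := HasExt.standard C
  -- Both sides say that `Ext^i(X, Y) = 0` for all `X`, `Y` and all `i ≥ n`.
  simp only [hasProjectiveDimensionLT_iff, hasInjectiveDimensionLT_iff]
  exact ⟨fun h X i hi Y => @h Y i hi X, fun h X i hi Y => @h Y i hi X⟩

end Homological

/-! ### Restriction, coextension and descent of global dimension. -/

section ChangeOfRings

open ModuleCat

variable {R S : Type u} [Ring R] [Ring S] (f : R →+* S)

instance coextendScalars_additive : (coextendScalars.{u, u, u} f).Additive where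
  map_add := by
    intros
    rfl

instance coextendScalars_preservesInjectiveObjects :
    (coextendScalars.{u, u, u} f).PreservesInjectiveObjects :=
  Functor.preservesInjectiveObjects_of_adjunction_of_preservesMonomorphisms
    (restrictCoextendScalarsAdj.{u, u, u} f)

/-- Elements of the coextension are `R`-linear maps out of `S`, which lift along surjections when
`S` is projective. -/
theorem coextendScalars_preservesEpimorphisms
    (hS : Module.Projective R ((restrictScalars f).obj (of S S))) :
    (coextendScalars.{u, u, u} f).PreservesEpimorphisms where
  preserves {X Y} g hg := by
    rw [ModuleCat.epi_iff_surjective] at hg ⊢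
    intro q
    obtain ⟨p, hp⟩ := Module.projective_lifting_property g.hom
      (CoextendScalars.equiv f Y q) hg
    refine ⟨(CoextendScalars.equiv f X).symm p, CoextendScalars.ext hp⟩

theorem coextendScalars_map_shortExact
    (hS : Module.Projective R ((restrictScalars f).obj (of S S)))
    (T : ShortComplex (ModuleCat.{u} R)) (hT : T.ShortExact) :
    (T.map (coextendScalars.{u, u, u} f)).ShortExact := by
  have := coextendScalars_preservesEpimorphisms f hS
  have : Limits.PreservesLimits (coextendScalars.{u, u, u} f) :=
    (restrictCoextendScalarsAdj.{u, u, u} f).rightAdjoint_preservesLimits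
  have := hT.mono_f
  have := hT.epi_g
  have h := ((Functor.preservesFiniteLimits_tfae (coextendScalars.{u, u, u} f)).out 3 0 rfl rfl).1
    inferInstance T hT
  exact { exact := h.1, mono_f := h.2, epi_g := inferInstanceAs (Epi ((coextendScalars f).map T.g)) }

theorem restrictScalars_preservesProjectiveObjects
    (hS : Module.Projective R ((restrictScalars f).obj (of S S))) :
    (restrictScalars.{u} f).PreservesProjectiveObjects :=
  have := coextendScalars_preservesEpimorphisms f hS
  Functor.preservesProjectiveObjects_of_adjunction_of_preservesEpimorphisms
    (restrictCoextendScalarsAdj.{u, u, u} f)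

theorem restrictScalars_map_shortExact (T : ShortComplex (ModuleCat.{u} S)) (hT : T.ShortExact) :
    (T.map (restrictScalars.{u} f)).ShortExact :=
  have : Limits.PreservesFiniteLimits (restrictScalars.{u} f) := ⟨fun _ _ _ => ⟨inferInstance⟩⟩
  have : Limits.PreservesFiniteColimits (restrictScalars.{u} f) := ⟨fun _ _ _ => ⟨inferInstance⟩⟩
  hT.map_of_exact _

/-- If `R` is a bimodule direct summand of an overring `S` that is projective as a left
`R`-module, then the left global dimension of `R` is at most that of `S`. -/
theorem LeftGlobalDimensionLE.of_retraction
    (hS : Module.Projective R ((restrictScalars f).obj (of S S)))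
    (π : S →+ R) (hπ : ∀ r, π (f r) = r) (hl : ∀ r s, π (f r * s) = r * π s)
    (hr : ∀ r s, π (s * f r) = π s * r) {d : ℕ} (h : LeftGlobalDimensionLE S d) :
    LeftGlobalDimensionLE R d := by
  intro M
  have := restrictScalars_preservesProjectiveObjects f hS
  have h1 := hasProjectiveDimensionLT_functor_obj (restrictScalars.{u} f)
    (restrictScalars_map_shortExact f) d ((coextendScalars.{u, u, u} f).obj M) (h _)
  -- The map `m ↦ (s ↦ π s • m)` embeds `M` in `Hom_R(S, M)`, and evaluation at `1` splits it. Left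
  -- linearity of `π` makes each value `R`-linear; right linearity makes `i` linear.
  let i : M →ₗ[R] (restrictScalars f).obj ((coextendScalars.{u, u, u} f).obj M) :=
    { toFun := fun m => (CoextendScalars.equiv f M).symm
        { toFun := fun s : S => π s • m
          map_add' := fun s t : S => by
            change π (s + t) • m = _
            rw [map_add, add_smul]
          map_smul' := fun r (s : S) => by
            change π (f r * s) • m = r • π s • m
            rw [hl, mul_smul] }
      map_add' := fun m m' => CoextendScalars.ext <| LinearMap.ext fun s : S => smul_add (π s) m m'
      map_smul' := fun r m => CoextendScalars.ext <| LinearMap.ext fun s : S => by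
        change π s • r • m = π (s * f r) • m
        rw [hr, mul_smul] }
  have ret : Retract M ((restrictScalars f).obj ((coextendScalars.{u, u, u} f).obj M)) := by
    refine ⟨ModuleCat.ofHom (X := M)
      (Y := (restrictScalars f).obj ((coextendScalars.{u, u, u} f).obj M)) i,
      (restrictCoextendScalarsAdj.{u, u, u} f).counit.app M, ?_⟩
    ext m : 2
    change π (1 : S) • (m : M) = m
    rw [← map_one f, hπ, one_smul]
  exact ret.hasProjectiveDimensionLT _

theorem LeftGlobalDimensionLE.of_ringEquiv (e : R ≃+* S) {d : ℕ} (h : LeftGlobalDimensionLE S d) :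
    LeftGlobalDimensionLE R d := by
  refine .of_retraction (e : R →+* S) ?_ (e.symm : S →+ R) (by simp) (by simp) (by simp) h
  let g : R →ₗ[R] (restrictScalars (e : R →+* S)).obj (of S S) :=
    { toFun := fun r => e r
      map_add' := map_add e
      map_smul' := fun r s => map_mul e r s }
  exact Module.Projective.of_equiv (LinearEquiv.ofBijective g e.bijective)

end ChangeOfRings

/-! ### Global dimension of Ore extensions. -/

section OreExtension

open ModuleCat

variable {R S : Type u} [Ring R] [Ring S] {f : R →+* S} {σ : R →+* R} {x : S}

/-- The powers of `x` as a basis of `S` as a left `R`-module. -/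
noncomputable def powersBasis
    (hb : Function.Bijective fun p : ℕ →₀ R => p.sum fun i r => f r * x ^ i) :
    Module.Basis ℕ R ((restrictScalars f).obj (of S S)) :=
  .ofRepr (LinearEquiv.ofBijective
    (Finsupp.lsum ℕ fun i => LinearMap.toSpanSingleton R ((restrictScalars f).obj (of S S))
      (x ^ i : S)) hb).symm

theorem powersBasis_apply
    (hb : Function.Bijective fun p : ℕ →₀ R => p.sum fun i r => f r * x ^ i) (i : ℕ) :
    powersBasis hb i = (x ^ i : S) := by
  change Finsupp.sum (Finsupp.single i 1) (fun i r => f r * x ^ i) = x ^ i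
  rw [Finsupp.sum_single_index] <;> simp

variable (f σ x) in
/-- The `S`-linear map `Hom_R(S, N) → Hom_R(S, N^σ)` sending `g` to `s ↦ g (x * s) - x • g s`. -/
noncomputable def commutatorMap (hx : ∀ r, ∃ d, x * f r = f (σ r) * x + f d) (N : ModuleCat.{u} S) :
    (coextendScalars.{u, u, u} f).obj ((restrictScalars f).obj N) →ₗ[S]
      (coextendScalars.{u, u, u} f).obj ((restrictScalars (f.comp σ)).obj N) where
  toFun g := (CoextendScalars.equiv f _).symm
    { toFun := fun s : S => (g (x * s) - x • (g s : N) : N)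
      map_add' := fun s t : S => by
        have h1 : g (x * (s + t)) = g (x * s) + g (x * t) := by
          rw [mul_add]
          exact map_add (CoextendScalars.equiv f _ g) _ _
        have h2 : g (s + t) = g s + g t := map_add (CoextendScalars.equiv f _ g) _ _
        change (g (x * (s + t)) - x • (g (s + t) : N) : N) = _
        rw [h1, h2]
        change (g (x * s) + g (x * t) - x • (g s + g t : N) : N) =
          (g (x * s) - x • (g s : N)) + (g (x * t) - x • (g t : N))
        rw [smul_add]
        abel
      map_smul' := fun r (s : S) => by
        -- The terms in `d` cancel, leaving linearity for the `σ`-twisted action.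
        obtain ⟨d, hd⟩ := hx r
        have h0 (r : R) (s : S) : g (f r * s) = (f r • (g s : N) : N) :=
          (CoextendScalars.equiv f _ g).map_smul r (s : (restrictScalars f).obj (of S S))
        have h1 : g (x * (f r * s)) = (f (σ r) • (g (x * s) : N) + f d • (g s : N) : N) := by
          rw [← mul_assoc, hd, add_mul, mul_assoc, ← h0, ← h0]
          exact map_add (CoextendScalars.equiv f _ g) _ _
        change (g (x * (f r * s)) - x • (g (f r * s) : N) : N) =
          f (σ r) • (g (x * s) - x • (g s : N) : N)
        rw [h1, h0, ← mul_smul, hd, add_smul, mul_smul, smul_sub]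
        abel }
  map_add' g h := CoextendScalars.ext <| LinearMap.ext fun s : S => by
    change ((g (x * s) + h (x * s)) - x • (g s + h s : N) : N) =
      (g (x * s) - x • (g s : N)) + (h (x * s) - x • (h s : N))
    rw [smul_add]
    abel
  map_smul' t g := CoextendScalars.ext <| LinearMap.ext fun s : S => by
    change (g (x * s * t) - x • (g (s * t) : N) : N) = g (x * (s * t)) - x • (g (s * t) : N)
    rw [mul_assoc]

theorem commutatorMap_apply (hx : ∀ r, ∃ d, x * f r = f (σ r) * x + f d) (N : ModuleCat.{u} S)
    (g : (coextendScalars.{u, u, u} f).obj ((restrictScalars f).obj N)) (s : S) :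
    commutatorMap f σ x hx N g s = (g (x * s) - x • (g s : N) : N) := rfl

theorem commutatorMap_surjective
    (hb : Function.Bijective fun p : ℕ →₀ R => p.sum fun i r => f r * x ^ i)
    (hx : ∀ r, ∃ d, x * f r = f (σ r) * x + f d) (N : ModuleCat.{u} S) :
    Function.Surjective (commutatorMap f σ x hx N) := by
  intro h
  -- A preimage of `h` must satisfy `g (x ^ (i + 1)) = h (x ^ i) + x • g (x ^ i)`; freeness on the
  -- powers of `x` lets this recursion, started at `0`, define `g`.
  let c : ℕ → N := fun i =>
    Nat.rec (motive := fun _ => N) 0 (fun i n => (show N from h (x ^ i)) + x • n) i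
  let g : (coextendScalars.{u, u, u} f).obj ((restrictScalars f).obj N) :=
    (CoextendScalars.equiv f _).symm
      ((powersBasis hb).constr ℕ (M' := (restrictScalars f).obj N) c)
  have hg (i : ℕ) : g (x ^ i) = c i := by
    rw [← powersBasis_apply hb]
    exact (powersBasis hb).constr_basis ℕ (M' := (restrictScalars f).obj N) c i
  refine ⟨g, CoextendScalars.ext <| (powersBasis hb).ext fun i => ?_⟩
  rw [powersBasis_apply]
  change (g (x * x ^ i) - x • (g (x ^ i) : N) : N) = h (x ^ i)
  rw [← pow_succ', hg, hg]
  exact add_sub_cancel_right (show N from h (x ^ i)) (x • c i)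

/-- A map killed by the commutator commutes with `x`, so it is determined by its value at `1`. -/
theorem commutatorMap_exact
    (hb : Function.Bijective fun p : ℕ →₀ R => p.sum fun i r => f r * x ^ i)
    (hx : ∀ r, ∃ d, x * f r = f (σ r) * x + f d) (N : ModuleCat.{u} S) :
    Function.Exact ((restrictCoextendScalarsAdj.{u, u, u} f).unit.app N).hom
      (commutatorMap f σ x hx N) := by
  intro (g : (coextendScalars.{u, u, u} f).obj ((restrictScalars f).obj N))
  constructor
  · intro hg
    have hxs (s : S) : g (x * s) = (x • (g s : N) : N) := by
      have : commutatorMap f σ x hx N g s = (0 : N) := by rw [hg]; rfl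
      exact sub_eq_zero.1 (commutatorMap_apply hx N g s ▸ this)
    refine ⟨(g (1 : S) : N), CoextendScalars.ext <| (powersBasis hb).ext fun i => ?_⟩
    rw [powersBasis_apply]
    change (x ^ i • (g (1 : S) : N) : N) = g (x ^ i)
    induction i with
    | zero => simp
    | succ i ih => rw [pow_succ', hxs, ← ih, mul_smul]
  · rintro ⟨n, rfl⟩
    refine CoextendScalars.ext <| LinearMap.ext fun s : S => ?_
    change (x * s) • (n : N) - x • s • (n : N) = 0
    rw [mul_smul, sub_self]

/-- The left global dimension of an Ore extension `R[x; σ, δ]` is at most one more than that of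
`R`. -/
theorem LeftGlobalDimensionLE.ore_extension
    (hb : Function.Bijective fun p : ℕ →₀ R => p.sum fun i r => f r * x ^ i)
    (hx : ∀ r, ∃ d, x * f r = f (σ r) * x + f d) {d : ℕ} (h : LeftGlobalDimensionLE R d) :
    LeftGlobalDimensionLE S (d + 1) := by
  have hS : Module.Projective R ((restrictScalars f).obj (of S S)) :=
    .of_basis (powersBasis hb)
  have hinj := (forall_hasProjectiveDimensionLT_iff (d + 1)).1 h
  refine (forall_hasProjectiveDimensionLT_iff (d + 1 + 1)).2 fun N => ?_
  -- In `0 → N → Hom_R(S, N) → Hom_R(S, N^σ) → 0` the last two terms are coextended, hence of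
  -- injective dimension at most `d`. Using `Hom` rather than tensor products requires only that `S`
  -- be free as a left module.
  have hcoext (M : ModuleCat.{u} R) :=
    hasInjectiveDimensionLT_functor_obj (coextendScalars.{u, u, u} f)
      (coextendScalars_map_shortExact f hS) d M (hinj M)
  let T : ShortComplex (ModuleCat.{u} S) :=
    { f := (restrictCoextendScalarsAdj.{u, u, u} f).unit.app N
      g := ModuleCat.ofHom (commutatorMap f σ x hx N)
      zero := by
        ext n : 2
        exact (commutatorMap_exact hb hx N _).2 ⟨n, rfl⟩ }
  have hT : T.ShortExact := ModuleCat.shortComplex_shortExact T (commutatorMap_exact hb hx N)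
    (fun m n hmn => by
      have := congrArg (fun g => (CoextendScalars.equiv f _ g) (1 : S)) hmn
      change (1 : S) • (m : N) = (1 : S) • (n : N) at this
      simpa using this)
    (commutatorMap_surjective hb hx N)
  have h2 : HasInjectiveDimensionLT T.X₂ (d + 1) := hcoext _
  exact hT.hasInjectiveDimensionLT_X₁ (d + 1) (hcoext _) (hasInjectiveDimensionLT_of_ge _ (d + 1) _ (by lia))

end OreExtension

/-! ### `V a` as an iterated Ore extension. -/

namespace ModifiedQuantumWeyl

variable {k : Type u} [Field k] {n : ℕ}

/-- The universal property of `V a`. -/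
noncomputable def lift {A : Type*} [Ring A] [Algebra k A] (a : Fin n → Fin n → k) (y : Fin n → A)
    (hy : ∀ i j, i < j → y i * y j + y j * y i = algebraMap k A (a i j)) : V a →ₐ[k] A :=
  RingQuot.liftAlgHom k ⟨FreeAlgebra.lift k y, by
    rintro _ _ ⟨i, j, hij⟩
    simpa using hy i j hij⟩

theorem lift_x {A : Type*} [Ring A] [Algebra k A] (a : Fin n → Fin n → k) (y : Fin n → A)
    (hy : ∀ i j, i < j → y i * y j + y j * y i = algebraMap k A (a i j)) (i : Fin n) :
    lift a y hy (x a i) = y i := by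
  have h : lift a y hy (x a i) = FreeAlgebra.lift k y (FreeAlgebra.ι k i) :=
    RingQuot.liftAlgHom_mkAlgHom_apply k _ _ _
  simpa using h

theorem adjoin_range_x (a : Fin n → Fin n → k) : Algebra.adjoin k (Set.range (x a)) = ⊤ := by
  have h : Function.Surjective (mk a) := RingQuot.mkAlgHom_surjective k (Rel a)
  have h2 : Set.range (x a) = mk a '' Set.range (FreeAlgebra.ι k) := by
    rw [← Set.range_comp]
    rfl
  rw [h2, ← AlgHom.map_adjoin, FreeAlgebra.adjoin_range_ι, Algebra.map_top, AlgHom.range_eq_top]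
  exact h

@[elab_as_elim]
theorem induction {a : Fin n → Fin n → k} {p : V a → Prop} (v : V a)
    (algebraMap : ∀ c, p (algebraMap k (V a) c)) (x : ∀ i, p (x a i))
    (add : ∀ u v, p u → p v → p (u + v)) (mul : ∀ u v, p u → p v → p (u * v)) : p v := by
  have hv : v ∈ Algebra.adjoin k (Set.range (ModifiedQuantumWeyl.x a)) := by
    rw [adjoin_range_x]
    trivial
  induction hv using Algebra.adjoin_induction with
  | mem v hv =>
    obtain ⟨i, rfl⟩ := hv
    exact x i
  | algebraMap c => exact algebraMap c
  | add u v _ _ hu hv => exact add u v hu hv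
  | mul u v _ _ hu hv => exact mul u v hu hv

theorem algHom_ext {A : Type*} [Semiring A] [Algebra k A] {a : Fin n → Fin n → k}
    {f g : V a →ₐ[k] A} (h : ∀ i, f (x a i) = g (x a i)) : f = g := by
  ext v
  induction v using induction with
  | algebraMap c => simp
  | x i => exact h i
  | add u v hu hv => simp [hu, hv]
  | mul u v hu hv => simp [hu, hv]

theorem x_anticomm_of_ne (a : Fin n → Fin n → k) {i j : Fin n} (hij : i ≠ j) :
    ∃ c, x a i * x a j = algebraMap k (V a) c - x a j * x a i := by
  rcases lt_or_gt_of_ne hij with h | h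
  · exact ⟨a i j, by rw [← x_anticomm a i j h, add_sub_cancel_right]⟩
  · exact ⟨a j i, by rw [← x_anticomm a j i h, add_sub_cancel_left]⟩

section Ore

variable (a : Fin (n + 1) → Fin (n + 1) → k)

/-- The scalars indexed by all but the last generator. -/
def initScalars : Fin n → Fin n → k := fun i j => a i.castSucc j.castSucc

/-- The inclusion of the subalgebra generated by all but the last generator. -/
noncomputable def inclInit : V (initScalars a) →ₐ[k] V a :=
  lift _ (fun i => x a i.castSucc) fun _ _ hij =>
    x_anticomm a _ _ (Fin.castSucc_lt_castSucc_iff.2 hij)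

theorem inclInit_x (i : Fin n) : inclInit a (x _ i) = x a i.castSucc := lift_x ..

/-- The elements `r` with this property form a subalgebra, since `negHom` is multiplicative, and the
defining relations put the generators in it. -/
theorem x_last_mul_inclInit (r : V (initScalars a)) :
    ∃ d, x a (Fin.last n) * inclInit a r =
      inclInit a (negHom _ r) * x a (Fin.last n) + inclInit a d := by
  induction r using induction with
  | algebraMap c =>
    refine ⟨0, ?_⟩
    simp [Algebra.commutes]
  | x i =>
    refine ⟨algebraMap k _ (a i.castSucc (Fin.last n)), ?_⟩
    rw [negHom_x, map_neg, inclInit_x, AlgHom.commutes,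
      ← x_anticomm a _ _ (Fin.castSucc_lt_last i)]
    noncomm_ring
  | add u v hu hv =>
    obtain ⟨d, hd⟩ := hu
    obtain ⟨e, he⟩ := hv
    refine ⟨d + e, ?_⟩
    simp only [map_add, mul_add, hd, he]
    noncomm_ring
  | mul u v hu hv =>
    obtain ⟨d, hd⟩ := hu
    obtain ⟨e, he⟩ := hv
    refine ⟨negHom _ u * e + d * v, ?_⟩
    simp only [map_add, map_mul]
    rw [← mul_assoc, hd, add_mul, mul_assoc, he]
    noncomm_ring

/-- The map `r ↦ !![σ r, δ r; 0, r]`, where `σ` is the automorphism `-1` and `δ` is the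
`σ`-derivation of `V (initScalars a)` defining `V a` as an Ore extension. -/
noncomputable def skewDerivationHom :
    V (initScalars a) →ₐ[k] Matrix (Fin 2) (Fin 2) (V (initScalars a)) :=
  lift _ (fun i => !![-x _ i, algebraMap k _ (a i.castSucc (Fin.last n)); 0, x _ i])
      fun i j hij => by
    have h := x_anticomm (initScalars a) i j hij
    ext p q
    fin_cases p <;> fin_cases q
    · simpa [Matrix.mul_apply, Matrix.algebraMap_eq_diagonal] using h
    -- In the corner entry the scalars are central, so the four terms cancel in pairs.
    · simp only [Matrix.add_apply, Matrix.mul_apply, Fin.sum_univ_two, Matrix.algebraMap_eq_diagonal]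
      simp [Algebra.commutes]
    · simp [Matrix.algebraMap_eq_diagonal]
    · simpa [Matrix.mul_apply, Matrix.algebraMap_eq_diagonal] using h

theorem skewDerivationHom_x (i : Fin n) : skewDerivationHom a (x _ i) =
    !![-x _ i, algebraMap k _ (a i.castSucc (Fin.last n)); 0, x _ i] := lift_x ..

/-- With this triangular shape, multiplicativity in the upper right entry becomes the twisted
Leibniz rule. -/
theorem skewDerivationHom_apply (r : V (initScalars a)) :
    skewDerivationHom a r 0 0 = negHom _ r ∧ skewDerivationHom a r 1 0 = 0 ∧
      skewDerivationHom a r 1 1 = r := by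
  induction r using induction with
  | algebraMap c => simp [Matrix.algebraMap_eq_diagonal]
  | x i => simp [skewDerivationHom_x, negHom_x]
  | add u v hu hv => simp [hu, hv]
  | mul u v hu hv => simp [Matrix.mul_apply, hu, hv]

/-- The `σ`-derivation `δ` of `V (initScalars a)` defining `V a` as an Ore extension. -/
noncomputable def skewDerivation : V (initScalars a) →+ V (initScalars a) where
  toFun r := skewDerivationHom a r 0 1
  map_zero' := by simp
  map_add' := by simp

theorem skewDerivation_mul (r s : V (initScalars a)) : skewDerivation a (r * s) =
    negHom _ r * skewDerivation a s + skewDerivation a r * s := by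
  simp [skewDerivation, Matrix.mul_apply, skewDerivationHom_apply]

theorem skewDerivation_x (i : Fin n) :
    skewDerivation a (x _ i) = algebraMap k _ (a i.castSucc (Fin.last n)) := by
  simp [skewDerivation, skewDerivationHom_x]

theorem skewDerivation_algebraMap (c : k) : skewDerivation a (algebraMap k _ c) = 0 := by
  simp [skewDerivation, Matrix.algebraMap_eq_diagonal]

/-- The operator by which the last generator acts on `⨁ i, V (initScalars a)`. -/
noncomputable def lastOperator : Module.End k (ℕ →₀ V (initScalars a)) :=
  Finsupp.lsum k fun i =>
    Finsupp.lsingle (i + 1) ∘ₗ (negHom _).toLinearMap +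
      Finsupp.lsingle i ∘ₗ
        { toFun := skewDerivation a
          map_add' := map_add _
          map_smul' := fun c r => by
            rw [Algebra.smul_def, skewDerivation_mul, skewDerivation_algebraMap]
            simp [Algebra.smul_def] }

/-- Index `i` stands for the `i`-th power of the last generator `x`: this is the normal form of `x *
(r * x ^ i)`. -/
theorem lastOperator_single (i : ℕ) (r : V (initScalars a)) :
    lastOperator a (Finsupp.single i r) =
      Finsupp.single (i + 1) (negHom _ r) + Finsupp.single i (skewDerivation a r) := by
  simp [lastOperator]

/-- The action of `V a` on `⨁ i, V (initScalars a)`. -/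
noncomputable def finsuppAction : V a →ₐ[k] Module.End k (ℕ →₀ V (initScalars a)) :=
  lift a (Fin.lastCases (lastOperator a) fun i =>
      Algebra.lsmul k k (ℕ →₀ V (initScalars a)) (x (initScalars a) i)) <| by
    intro i j hij
    induction j using Fin.lastCases with
    | last =>
      induction i using Fin.lastCases with
      | last => simp at hij
      | cast i =>
        ext m r : 2
        rw [Fin.lastCases_last, Fin.lastCases_castSucc]
        simp [lastOperator_single, skewDerivation_mul, negHom_x, skewDerivation_x,
          Algebra.smul_def, -Finsupp.single_mul]
        abel
    | cast j =>
      induction i using Fin.lastCases with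
      | last => exact absurd hij (by simpa using (Fin.castSucc_lt_last j).le)
      | cast i =>
        rw [Fin.lastCases_castSucc, Fin.lastCases_castSucc, ← map_mul, ← map_mul, ← map_add,
          x_anticomm _ _ _ (Fin.castSucc_lt_castSucc_iff.1 hij), AlgHom.commutes]
        rfl

theorem finsuppAction_x_last : finsuppAction a (x a (Fin.last n)) = lastOperator a := by
  rw [finsuppAction, lift_x, Fin.lastCases_last]

theorem finsuppAction_inclInit (r : V (initScalars a)) (p : ℕ →₀ V (initScalars a)) :
    finsuppAction a (inclInit a r) p = r • p := by
  have h : (finsuppAction a).comp (inclInit a) =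
      Algebra.lsmul k k (ℕ →₀ V (initScalars a)) := algHom_ext fun i => by
    rw [AlgHom.comp_apply, inclInit_x, finsuppAction, lift_x, Fin.lastCases_castSucc]
  exact LinearMap.congr_fun (DFunLike.congr_fun h r) p

theorem lastOperator_pow_single (i : ℕ) :
    (lastOperator a ^ i) (Finsupp.single 0 1) = Finsupp.single i 1 := by
  induction i with
  | zero => rfl
  | succ i ih =>
    rw [pow_succ', Module.End.mul_apply, ih, lastOperator_single, map_one,
      ← map_one (algebraMap k (V (initScalars a))), skewDerivation_algebraMap, Finsupp.single_zero, add_zero]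

/-- The algebra `V a` is free as a left module over the subalgebra generated by all but the last
generator, on the powers of the last generator. -/
theorem bijective_sum_inclInit_mul_pow : Function.Bijective fun p : ℕ →₀ V (initScalars a) =>
    p.sum fun i r => inclInit a r * x a (Fin.last n) ^ i := by
  constructor
  -- Acting on `Finsupp.single 0 1` reads the coefficients back off.
  · refine Function.LeftInverse.injective (g := fun v => finsuppAction a v (Finsupp.single 0 1))
      fun p => ?_
    simp only [Finsupp.sum, map_sum, map_mul, map_pow, finsuppAction_x_last,
      LinearMap.sum_apply, Module.End.mul_apply, lastOperator_pow_single, finsuppAction_inclInit,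
      Finsupp.smul_single, smul_eq_mul, mul_one]
    exact p.sum_single
  · let Φ : (ℕ →₀ V (initScalars a)) →+ V a := Finsupp.liftAddHom fun i =>
      (AddMonoidHom.mulRight (x a (Fin.last n) ^ i)).comp (inclInit a : V (initScalars a) →+ V a)
    have hΦ (i r) : Φ (Finsupp.single i r) = inclInit a r * x a (Fin.last n) ^ i := by simp [Φ]
    -- The range contains `1`, so it is everything once it is a left ideal.
    suffices h : ∀ v w, w ∈ Φ.range → v * w ∈ Φ.range by
      intro v
      obtain ⟨p, hp⟩ := h v 1 ⟨Finsupp.single 0 1, by simp [hΦ]⟩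
      exact ⟨p, hp.trans (mul_one v)⟩
    have hincl (r w) (hw : w ∈ Φ.range) : inclInit a r * w ∈ Φ.range := by
      obtain ⟨p, rfl⟩ := hw
      induction p using Finsupp.induction_linear with
      | zero => simp
      | add p q hp hq =>
        rw [map_add, mul_add]
        exact add_mem hp hq
      | single i s => exact ⟨Finsupp.single i (r * s), by rw [hΦ, hΦ, map_mul, mul_assoc]⟩
    intro v
    induction v using induction with
    | algebraMap c =>
      intro w hw
      rw [← (inclInit a).commutes]
      exact hincl _ _ hw
    | add u v hu hv =>
      intro w hw
      rw [add_mul]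
      exact add_mem (hu w hw) (hv w hw)
    | mul u v hu hv =>
      intro w hw
      rw [mul_assoc]
      exact hu _ (hv w hw)
    | x i =>
      intro w hw
      induction i using Fin.lastCases with
      | cast i =>
        rw [← inclInit_x]
        exact hincl _ _ hw
      | last =>
        obtain ⟨p, rfl⟩ := hw
        induction p using Finsupp.induction_linear with
        | zero => simp
        | add p q hp hq =>
          rw [map_add, mul_add]
          exact add_mem hp hq
        | single i s =>
          obtain ⟨d, hd⟩ := x_last_mul_inclInit a s
          refine ⟨Finsupp.single (i + 1) (negHom _ s) + Finsupp.single i d, ?_⟩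
          rw [map_add, hΦ, hΦ, hΦ, ← mul_assoc, hd, add_mul, mul_assoc, pow_succ']

end Ore

theorem leftGlobalDimensionLE : ∀ {n : ℕ} (a : Fin n → Fin n → k), LeftGlobalDimensionLE (V a) n
  | 0, a => by
    have hsurj : Function.Surjective (algebraMap k (V a)) := fun v => by
      induction v using induction with
      | algebraMap c => exact ⟨c, rfl⟩
      | x i => exact i.elim0
      | add u v hu hv =>
        obtain ⟨⟨c, rfl⟩, ⟨d, rfl⟩⟩ := hu, hv
        exact ⟨c + d, map_add ..⟩
      | mul u v hu hv =>
        obtain ⟨⟨c, rfl⟩, ⟨d, rfl⟩⟩ := hu, hv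
        exact ⟨c * d, map_mul ..⟩
    have : IsSemisimpleRing (V a) := RingHom.isSemisimpleRing_of_surjective _ hsurj
    intro M
    rw [← projective_iff_hasProjectiveDimensionLE_zero, ← IsProjective.iff_projective]
    exact Module.projective_of_isSemisimpleRing _ _
  | n + 1, a => LeftGlobalDimensionLE.ore_extension (f := (inclInit a : V (initScalars a) →+* V a))
      (σ := (negHom (initScalars a) : V (initScalars a) →+* V (initScalars a)))
      (bijective_sum_inclInit_mul_pow a)
      (x_last_mul_inclInit a) (leftGlobalDimensionLE (initScalars a))

end ModifiedQuantumWeyl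

/-! ### Noetherianity. -/

/-- If `R` is a direct summand of an overring `S` as a right `R`-module and `S` is left noetherian,
then so is `R`. -/
theorem IsNoetherianRing.of_retraction {R S : Type*} [Ring R] [Ring S] (f : R →+* S)
    (π : S →+ R) (hπ : ∀ r, π (f r) = r) (hr : ∀ r s, π (s * f r) = π s * r)
    [IsNoetherianRing S] : IsNoetherianRing R := by
  have key (I : Ideal R) (s : S) (hs : s ∈ I.map f) : π s ∈ I := by
    -- The factor `t` absorbs the left coefficients in the span.
    have h : ∀ t, π (t * s) ∈ I := by
      induction hs using Submodule.span_induction with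
      | mem s hs =>
        obtain ⟨r, hr', rfl⟩ := hs
        intro t
        rw [hr]
        exact I.mul_mem_left _ hr'
      | zero => simp
      | add u v _ _ hu hv =>
        intro t
        rw [mul_add, map_add]
        exact I.add_mem (hu t) (hv t)
      | smul c u _ hu =>
        intro t
        rw [smul_eq_mul, ← mul_assoc]
        exact hu _
    simpa using h 1
  -- An ideal is recovered from its extension through `π`, so strict chains in `R` stay strict in
  -- `S`.
  have hinj : StrictMono (Ideal.map f) := by
    refine Monotone.strictMono_of_injective (fun _ _ => Ideal.map_mono) fun I J hIJ => ?_
    refine le_antisymm (fun r hr => ?_) fun r hr => ?_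
    · rw [← hπ r]
      exact key J _ (hIJ ▸ Ideal.mem_map_of_mem f hr)
    · rw [← hπ r]
      exact key I _ (hIJ ▸ Ideal.mem_map_of_mem f hr)
  rw [isNoetherianRing_iff, isNoetherian_iff']
  exact hinj.wellFoundedGT

namespace ModifiedQuantumWeyl

variable {k : Type u} [Field k] {n : ℕ}

/-- Moving `x j` past `x i` twice cancels both the sign and the scalar correction. -/
theorem commute_x_sq (a : Fin n → Fin n → k) (i : Fin n) (v : V a) : Commute v (x a i ^ 2) := by
  induction v using induction with
  | algebraMap c => exact Algebra.commutes c _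
  | x j =>
    obtain rfl | hij := eq_or_ne i j
    · exact (Commute.refl _).pow_right 2
    · obtain ⟨c, hc⟩ := x_anticomm_of_ne a hij
      have hc' : x a j * x a i = algebraMap k _ c - x a i * x a j := by rw [hc, sub_sub_cancel]
      rw [commute_iff_eq, sq, ← mul_assoc, hc', sub_mul, mul_assoc, hc', mul_sub,
        Algebra.commutes, mul_assoc]
      noncomm_ring
  | add u v hu hv => exact hu.add_left hv
  | mul u v hu hv => exact hu.mul_left hv

/-- The map from the polynomial ring to the center sending the variables to the squares of the
generators. -/
noncomputable def squares (a : Fin n → Fin n → k) :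
    MvPolynomial (Fin n) k →ₐ[k] Subalgebra.center k (V a) :=
  MvPolynomial.aeval fun i => ⟨x a i ^ 2, Subalgebra.mem_center_iff.2 fun v => commute_x_sq a i v⟩

section Noetherian

variable (C : Type*) [CommRing C] (a : Fin n → Fin n → k) [Algebra C (V a)]

/-- The span of `1` and `x i`. -/
def spanOneX (i : Fin n) : Submodule C (V a) := Submodule.span C {1, x a i}

variable {C a}

theorem one_mem_spanOneX (i : Fin n) : 1 ∈ spanOneX C a i := Submodule.subset_span (by simp)

theorem x_mem_spanOneX (i : Fin n) : x a i ∈ spanOneX C a i := Submodule.subset_span (by simp)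

theorem spanOneX_mul_self_le (hC : ∀ i, ∃ c, algebraMap C (V a) c = x a i ^ 2) (i : Fin n) :
    spanOneX C a i * spanOneX C a i ≤ spanOneX C a i := by
  nth_rw 1 2 [spanOneX]
  rw [Submodule.span_mul_span, Submodule.span_le]
  rintro _ ⟨u, rfl | rfl, v, rfl | rfl, rfl⟩
  · simpa using one_mem_spanOneX i
  · simpa using x_mem_spanOneX i
  · simpa using x_mem_spanOneX i
  · obtain ⟨c, hc⟩ := hC i
    change x a i * x a i ∈ spanOneX C a i
    rw [← sq, ← hc, Algebra.algebraMap_eq_smul_one]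
    exact Submodule.smul_mem _ _ (one_mem_spanOneX i)

variable [Algebra k C] [IsScalarTower k C (V a)]

theorem spanOneX_mul_le (i j : Fin n) :
    spanOneX C a i * spanOneX C a j ≤ spanOneX C a j * spanOneX C a i := by
  obtain rfl | hij := eq_or_ne i j
  · rfl
  refine (Submodule.span_mul_span C {1, x a i} {1, x a j}).trans_le (Submodule.span_le.2 ?_)
  have h1 : (1 : V a) ∈ spanOneX C a j * spanOneX C a i := by
    simpa using Submodule.mul_mem_mul (one_mem_spanOneX (C := C) j) (one_mem_spanOneX (a := a) i)
  rintro _ ⟨u, rfl | rfl, v, rfl | rfl, rfl⟩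
  · simpa using h1
  · simpa using Submodule.mul_mem_mul (x_mem_spanOneX (C := C) j) (one_mem_spanOneX (a := a) i)
  · simpa using Submodule.mul_mem_mul (one_mem_spanOneX (C := C) j) (x_mem_spanOneX (a := a) i)
  · obtain ⟨c, hc⟩ := x_anticomm_of_ne a hij
    change x a i * x a j ∈ spanOneX C a j * spanOneX C a i
    rw [hc]
    refine sub_mem ?_ (Submodule.mul_mem_mul (x_mem_spanOneX j) (x_mem_spanOneX i))
    rw [IsScalarTower.algebraMap_apply k C (V a), Algebra.algebraMap_eq_smul_one]
    exact Submodule.smul_mem _ _ h1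

/-- Move the extra factor rightwards to the occurrence of `i` in the list, where it is absorbed
because the square of `x i` comes from `C`. -/
theorem spanOneX_mul_prod_le (hC : ∀ i, ∃ c, algebraMap C (V a) c = x a i ^ 2) (i : Fin n)
    (l : List (Fin n)) (hi : i ∈ l) :
    spanOneX C a i * (l.map (spanOneX C a)).prod ≤ (l.map (spanOneX C a)).prod := by
  induction l with
  | nil => simp at hi
  | cons j l ih =>
    rw [List.map_cons, List.prod_cons, ← mul_assoc]
    by_cases hij : i = j
    · subst hij
      exact mul_le_mul_left (spanOneX_mul_self_le hC i) _
    · refine (mul_le_mul_left (spanOneX_mul_le i j) _).trans ?_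
      rw [mul_assoc]
      exact mul_le_mul_right (ih (by simpa [hij] using hi)) _

/-- `V a` is finite over any algebra of central elements containing the squares of the
generators. -/
theorem finite_of_sq_mem (hC : ∀ i, ∃ c, algebraMap C (V a) c = x a i ^ 2) :
    Module.Finite C (V a) := by
  -- `P` is spanned by the ordered square-free monomials. It contains `1` and is a left ideal, hence
  -- is all of `V a`.
  set P := ((List.finRange n).map (spanOneX C a)).prod
  have hfg : ∀ l : List (Fin n), ((l.map (spanOneX C a)).prod).FG := by
    intro l
    induction l with
    | nil =>
      rw [List.map_nil, List.prod_nil, Submodule.one_eq_span]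
      exact Submodule.fg_span_singleton _
    | cons j l ih => exact (Submodule.fg_span (by simp)).mul ih
  have h1 : ∀ l : List (Fin n), (1 : V a) ∈ (l.map (spanOneX C a)).prod := by
    intro l
    induction l with
    | nil => exact Submodule.one_le.1 le_rfl
    | cons j l ih => simpa using Submodule.mul_mem_mul (one_mem_spanOneX (C := C) (a := a) j) ih
  have hmul : ∀ v w : V a, w ∈ P → v * w ∈ P := by
    intro v
    induction v using induction with
    | algebraMap c =>
      intro w hw
      rw [IsScalarTower.algebraMap_apply k C (V a), ← Algebra.smul_def]
      exact P.smul_mem _ hw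
    | x i =>
      intro w hw
      exact spanOneX_mul_prod_le hC i _ (List.mem_finRange i)
        (Submodule.mul_mem_mul (x_mem_spanOneX i) hw)
    | add u v hu hv =>
      intro w hw
      rw [add_mul]
      exact add_mem (hu w hw) (hv w hw)
    | mul u v hu hv =>
      intro w hw
      rw [mul_assoc]
      exact hu _ (hv w hw)
  refine ⟨?_⟩
  rw [← show P = ⊤ from eq_top_iff.2 fun v _ => mul_one v ▸ hmul v 1 (h1 _)]
  exact hfg _

end Noetherian

instance isNoetherianRing (a : Fin n → Fin n → k) : IsNoetherianRing (V a) := by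
  let φ : MvPolynomial (Fin n) k →+* V a := (Subalgebra.center k (V a)).subtype.comp (squares a)
  let : Algebra (MvPolynomial (Fin n) k) (V a) :=
    φ.toAlgebra' fun c v => (Subalgebra.mem_center_iff.1 (squares a c).2 v).symm
  have : IsScalarTower k (MvPolynomial (Fin n) k) (V a) := .of_algebraMap_eq fun c =>
    ((Subalgebra.center k (V a)).val.comp (squares a)).commutes c |>.symm
  have : Module.Finite (MvPolynomial (Fin n) k) (V a) := finite_of_sq_mem fun i =>
    ⟨MvPolynomial.X i, by
      change ((squares a (MvPolynomial.X i) : Subalgebra.center k (V a)) : V a) = _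
      simp [squares]⟩
  have : IsNoetherian (MvPolynomial (Fin n) k) (V a) :=
    isNoetherian_of_isNoetherianRing_of_finite _ _
  exact isNoetherian_of_tower (MvPolynomial (Fin n) k) this

/-! ### The fixed ring: opposite ring, averaging and projectivity. -/

/-- The anti-automorphism of `V a` fixing the generators. -/
noncomputable def opHom (a : Fin n → Fin n → k) : V a →ₐ[k] (V a)ᵐᵒᵖ :=
  lift a (fun i => MulOpposite.op (x a i)) fun i j hij => by
    rw [← MulOpposite.op_mul, ← MulOpposite.op_mul, ← MulOpposite.op_add, add_comm,
      x_anticomm a i j hij]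
    rfl

theorem opHom_x (a : Fin n → Fin n → k) (i : Fin n) :
    opHom a (x a i) = MulOpposite.op (x a i) := lift_x ..

theorem unop_opHom_unop_opHom (a : Fin n → Fin n → k) (v : V a) :
    (opHom a (opHom a v).unop).unop = v := by
  induction v using induction with
  | algebraMap c => simp
  | x i => simp [opHom_x]
  | add u v hu hv => simp [hu, hv]
  | mul u v hu hv => simp [hu, hv]

theorem negHom_unop_opHom (a : Fin n → Fin n → k) (v : V a) :
    negHom a (opHom a v).unop = (opHom a (negHom a v)).unop := by
  induction v using induction with
  | algebraMap c => simp
  | x i => simp [opHom_x, negHom_x]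
  | add u v hu hv => simp [hu, hv]
  | mul u v hu hv => simp [hu, hv]

theorem negHom_negHom (a : Fin n → Fin n → k) (v : V a) : negHom a (negHom a v) = v :=
  DFunLike.congr_fun (negHom_comp_negHom a) v

theorem mem_fixedRing_iff (a : Fin n → Fin n → k) (v : V a) :
    v ∈ fixedRing a ↔ negHom a v = v := by
  constructor
  · intro h
    exact h ⟨negAut a, Subgroup.mem_zpowers _⟩
  · rintro h ⟨g, hg⟩
    have : signGroup a ≤ MulAction.stabilizer _ v := by
      rw [signGroup, Subgroup.zpowers_le]
      exact h
    exact this hg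

/-- The fixed ring is isomorphic to its opposite ring. -/
noncomputable def fixedRingOpEquiv (a : Fin n → Fin n → k) :
    (fixedRing a)ᵐᵒᵖ ≃+* fixedRing a where
  toFun v := ⟨(opHom a v.unop).unop, by
    rw [mem_fixedRing_iff, negHom_unop_opHom, (mem_fixedRing_iff a _).1 v.unop.2]⟩
  invFun v := MulOpposite.op ⟨(opHom a v).unop, by
    rw [mem_fixedRing_iff, negHom_unop_opHom, (mem_fixedRing_iff a _).1 v.2]⟩
  left_inv v := by simp [unop_opHom_unop_opHom]
  right_inv v := by simp [unop_opHom_unop_opHom]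
  map_mul' u v := by ext; simp
  map_add' u v := by ext; simp

/-- The projection of `V a` onto its fixed ring, in characteristic not two. -/
noncomputable def average (a : Fin n → Fin n → k) : V a →+ fixedRing a where
  toFun v := ⟨(2⁻¹ : k) • (v + negHom a v), by
    rw [mem_fixedRing_iff, map_smul, map_add, negHom_negHom, add_comm]⟩
  map_zero' := by ext; simp
  map_add' u v := by
    ext
    simp only [map_add, Subalgebra.coe_add, ← smul_add]
    congr 1
    abel

theorem coe_average (a : Fin n → Fin n → k) (v : V a) :
    (average a v : V a) = (2⁻¹ : k) • (v + negHom a v) := rfl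

theorem negHom_coe (a : Fin n → Fin n → k) (r : fixedRing a) : negHom a r = r :=
  (mem_fixedRing_iff a _).1 r.2

theorem average_mul_left (a : Fin n → Fin n → k) (r : fixedRing a) (v : V a) :
    average a (r * v) = r * average a v := by
  ext
  simp [coe_average, negHom_coe, mul_add]

theorem average_mul_right (a : Fin n → Fin n → k) (r : fixedRing a) (v : V a) :
    average a (v * r) = average a v * r := by
  ext
  simp [coe_average, negHom_coe, add_mul]

theorem average_coe (h2 : (2 : k) ≠ 0) (a : Fin n → Fin n → k) (r : fixedRing a) :
    average a r = r := by
  ext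
  rw [coe_average, negHom_coe, ← two_smul k, smul_smul, inv_mul_cancel₀ h2, one_smul]

/-- If some scalar `a i j` is nonzero then `V a` is projective over its fixed ring. -/
theorem projective_fixedRing (h2 : (2 : k) ≠ 0) (a : Fin n → Fin n → k)
    (ha : ∃ i j : Fin n, i < j ∧ a i j ≠ 0) : Module.Projective (fixedRing a) (V a) := by
  obtain ⟨i, j, hij, hne⟩ := ha
  let averageMul (w : V a) : V a →ₗ[fixedRing a] fixedRing a :=
    { toFun := fun v => average a (v * w)
      map_add' := fun u v => by rw [add_mul, map_add]
      map_smul' := fun r v => by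
        rw [Subalgebra.smul_def, smul_eq_mul, mul_assoc, average_mul_left]
        rfl }
  let mulRight (w : V a) : fixedRing a →ₗ[fixedRing a] V a := LinearMap.toSpanSingleton _ _ w
  -- The dual basis pairs `1`, `x i`, `x j` with `1`, `(a i j)⁻¹ • x j`, `(a i j)⁻¹ • x i`. The
  -- first term returns the even part of `v`; averaging `v * x i` and `v * x j` sees only the odd
  -- part, which the other two terms rebuild from the anticommutation relation.
  refine .of_split (M := fixedRing a × fixedRing a × fixedRing a)
    ((averageMul 1).prod ((averageMul (x a i)).prod (averageMul (x a j))))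
    ((mulRight 1).coprod ((mulRight ((a i j)⁻¹ • x a j)).coprod (mulRight ((a i j)⁻¹ • x a i)))) ?_
  ext v
  have h : (a i j)⁻¹ • (x a i * x a j + x a j * x a i) = 1 := by
    rw [x_anticomm a i j hij, Algebra.algebraMap_eq_smul_one, smul_smul, inv_mul_cancel₀ hne,
      one_smul]
  have h' (w : V a) : (a i j)⁻¹ • (w * x a i * x a j + w * x a j * x a i) = w := by
    rw [mul_assoc, mul_assoc, ← mul_add, ← mul_smul_comm, h, mul_one]
  change ((2⁻¹ : k) • (v * 1 + negHom a (v * 1))) * 1 +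
    (((2⁻¹ : k) • (v * x a i + negHom a (v * x a i))) * (a i j)⁻¹ • x a j +
      ((2⁻¹ : k) • (v * x a j + negHom a (v * x a j))) * (a i j)⁻¹ • x a i) = v
  have h3 : (2⁻¹ : k) • (v + v) = v := by
    rw [← two_smul k, smul_smul, inv_mul_cancel₀ h2, one_smul]
  have h4 : (2⁻¹ : k) • (v + negHom a v + ((a i j)⁻¹ • (v * x a i * x a j + v * x a j * x a i)
      - (a i j)⁻¹ • (negHom a v * x a i * x a j + negHom a v * x a j * x a i))) = v := by
    rw [h', h', add_add_sub_cancel, h3]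
  refine Eq.trans ?_ h4
  simp only [map_mul, negHom_x, mul_one, smul_add, smul_sub, smul_mul_assoc,
    mul_smul_comm, add_mul, neg_mul, mul_neg, smul_neg, smul_comm (a i j)⁻¹ (2⁻¹ : k)]
  abel

theorem fixedRing_noetherian_and_leftGlobalDimensionLE (a : Fin n → Fin n → k)
    (ha : ∃ i j : Fin n, i < j ∧ a i j ≠ 0) :
    IsNoetherianRing (fixedRing a) ∧ LeftGlobalDimensionLE (fixedRing a) n := by
  by_cases h2 : (2 : k) = 0
  -- Here `-1 = 1`, so averaging is unavailable but the group is trivial.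
  · have hneg : negHom a = AlgHom.id k (V a) := algHom_ext fun i => by
      rw [negHom_x, AlgHom.id_apply, neg_eq_iff_add_eq_zero, ← two_smul k, h2, zero_smul]
    have htop : fixedRing a = ⊤ := by
      ext v
      simp [mem_fixedRing_iff, hneg]
    let e : fixedRing a ≃+* V a :=
      ((Subalgebra.equivOfEq _ _ htop).trans Subalgebra.topEquiv).toRingEquiv
    exact ⟨isNoetherianRing_of_ringEquiv _ e.symm, .of_ringEquiv e (leftGlobalDimensionLE a)⟩
  · exact ⟨.of_retraction ((fixedRing a).val : fixedRing a →+* V a) (average a)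
        (average_coe h2 a) (average_mul_right a),
      .of_retraction ((fixedRing a).val : fixedRing a →+* V a) (projective_fixedRing h2 a ha)
        (average a) (average_coe h2 a) (average_mul_left a) (average_mul_right a)
        (leftGlobalDimensionLE a)⟩

end ModifiedQuantumWeyl

theorem proposition1p8 {k : Type u} [Field k] {n : ℕ} (a : Fin n → Fin n → k)
    (ha : ∃ i j : Fin n, i < j ∧ a i j ≠ 0) :
    IsNoncommRegular (ModifiedQuantumWeyl.fixedRing a) := by
  obtain ⟨h1, h2⟩ := ModifiedQuantumWeyl.fixedRing_noetherian_and_leftGlobalDimensionLE a ha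
  let e := ModifiedQuantumWeyl.fixedRingOpEquiv a
  exact ⟨h1, isNoetherianRing_of_ringEquiv _ e.symm, ⟨n, h2⟩, ⟨n, .of_ringEquiv e h2⟩⟩
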